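/- Let $K$ be a compact metric space. A function $f:K\to\mathbb{R}$ (not assumed bounded) is of \emph{Baire class one} if it is the pointwise limit of a sequence of continuous real-valued functions on $K$. For $f:K\to\mathbb{R}$ and $\varepsilon>0$, put $K^{0}(f,\varepsilon)=K$; let $K^{\alpha+1}(f,\varepsilon)$ be the set of all $x\in K^{\alpha}(f,\varepsilon)$ such that for every open set $U$ containing $x$ there are $x_1,x_2\in U\cap K^{\alpha}(f,\varepsilon)$ with $|f(x_1)-f(x_2)|\ge\varepsilon$; and let $K^{\alpha}(f,\varepsilon)=\bigcap_{\alpha'<\alpha}K^{\alpha'}(f,\varepsilon)$ for limit ordinals $\alpha$. Let $\beta(f,\varepsilon)$ be the least countable ordinal $\alpha$ with $K^{\alpha}(f,\varepsilon)=\emptyset$ if such an $\alpha$ exists, and $\omega_1$ otherwise, and let $\beta(f)=\sup_{\varepsilon>0}\beta(f,\varepsilon)$ be the oscillation index of $f$. For a countable ordinal $\xi$, let $\mathfrak{B}_1^{\xi}(K)$ be the set of all functions $f:K\to\mathbb{R}$ of Baire class one with $\beta(f)\le\omega^{\xi}$. \textbf{Theorem.} Let $\xi_1,\xi_2$ be countable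 ordinals. If $f\in\mathfrak{B}_1^{\xi_1}(K)$ and $g\in\mathfrak{B}_1^{\xi_2}(K)$, then $fg\in\mathfrak{B}_1^{\xi}(K)$, where $\xi=\max\{\xi_1+\xi_2,\ \xi_2+\xi_1\}$. -/

import Mathlib

open scoped Ordinal

universe u

/-- A real-valued function is of Baire class one if it is the pointwise limit of a sequence of
continuous real-valued functions. -/
def IsBaireOne {X : Type u} [TopologicalSpace X] (f : X → ℝ) : Prop :=
  ∃ F : ℕ → X → ℝ, (∀ n, Continuous (F n)) ∧
    ∀ x, Filter.Tendsto (fun n => F n x) Filter.atTop (nhds (f x))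

/-- The `ε`-oscillation derivative of a set `S`: the points `x ∈ S` such that every open set
containing `x` contains two points of `S` at which the values of `f` differ by at least `ε`. -/
def oscDeriv {X : Type u} [TopologicalSpace X] (f : X → ℝ) (ε : ℝ) (S : Set X) : Set X :=
  {x | x ∈ S ∧ ∀ U : Set X, IsOpen U → x ∈ U →
    ∃ x₁ ∈ U ∩ S, ∃ x₂ ∈ U ∩ S, ε ≤ |f x₁ - f x₂|}

/-- The transfinite iterates `H^α(f, ε)` of the oscillation derivative, starting from `H`, with
intersections taken at limit ordinals. -/
noncomputable def oscIter {X : Type u} [TopologicalSpace X] (f : X → ℝ) (ε : ℝ) (H : Set X)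
    (α : Ordinal.{0}) : Set X :=
  Ordinal.limitRecOn (motive := fun _ => Set X) α H
    (fun _ S => oscDeriv f ε S)
    (fun a _ ih => ⋂ b : Ordinal.{0}, ⋂ h : b < a, ih b h)

theorem oscIter_zero {X : Type u} [TopologicalSpace X] (f : X → ℝ) (ε : ℝ) (H : Set X) :
    oscIter f ε H 0 = H :=
  Ordinal.limitRecOn_zero ..

theorem oscIter_add_one {X : Type u} [TopologicalSpace X] (f : X → ℝ) (ε : ℝ) (H : Set X)
    (α : Ordinal.{0}) : oscIter f ε H (α + 1) = oscDeriv f ε (oscIter f ε H α) :=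
  Ordinal.limitRecOn_add_one ..

theorem oscIter_limit {X : Type u} [TopologicalSpace X] (f : X → ℝ) (ε : ℝ) (H : Set X)
    {α : Ordinal.{0}} (hα : Order.IsSuccLimit α) :
    oscIter f ε H α = ⋂ b : Ordinal.{0}, ⋂ _ : b < α, oscIter f ε H b :=
  Ordinal.limitRecOn_limit _ _ _ _ hα

open Classical in
/-- The index `β_H(f, ε)`: the least countable ordinal `α` with `H^α(f, ε) = ∅` if there is one,
and `ω₁` otherwise. -/
noncomputable def oscIndexAt {X : Type u} [TopologicalSpace X] (f : X → ℝ) (ε : ℝ) (H : Set X) :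
    Ordinal.{0} :=
  if ∃ α : Ordinal.{0}, α < ω_ 1 ∧ oscIter f ε H α = ∅ then
    sInf {α : Ordinal.{0} | α < ω_ 1 ∧ oscIter f ε H α = ∅}
  else ω_ 1

/-- The oscillation index `β_H(f)`, the supremum of `β_H(f, ε)` over all `ε > 0`. -/
noncomputable def oscIndex {X : Type u} [TopologicalSpace X] (f : X → ℝ) (H : Set X) :
    Ordinal.{0} :=
  sSup {β : Ordinal.{0} | ∃ ε : ℝ, 0 < ε ∧ β = oscIndexAt f ε H}

theorem oscIndexAt_le {X : Type u} [TopologicalSpace X] (f : X → ℝ) (ε : ℝ) (H : Set X) :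
    oscIndexAt f ε H ≤ ω_ 1 := by
  unfold oscIndexAt
  split_ifs with h
  · exact (csInf_mem (s := {α : Ordinal.{0} | α < ω_ 1 ∧ oscIter f ε H α = ∅}) h).1.le
  · exact le_rfl

/-- The supremum defining the oscillation index is that of a bounded set of ordinals. -/
theorem oscIndex_isLUB {X : Type u} [TopologicalSpace X] (f : X → ℝ) (H : Set X) :
    IsLUB {β : Ordinal.{0} | ∃ ε : ℝ, 0 < ε ∧ β = oscIndexAt f ε H} (oscIndex f H) := by
  refine isLUB_csSup ⟨_, 1, one_pos, rfl⟩ ⟨ω_ 1, ?_⟩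
  rintro _ ⟨ε, _, rfl⟩
  exact oscIndexAt_le f ε H

/-- The class of functions of small Baire class `ξ` on `K`: the (possibly unbounded) functions of
Baire class one on `K` whose oscillation index on `K` is at most `ω ^ ξ`. -/
def smallBaireClass (K : Type u) [TopologicalSpace K] (ξ : Ordinal.{0}) : Set (K → ℝ) :=
  {f | IsBaireOne f ∧ oscIndex f Set.univ ≤ ω ^ ξ}

/-! Since fg(y) - fg(z) = g(z)(f(y) - f(z)) + f(y)(g(y) - g(z)), an oscillation of fg of size ε
forces one of the two terms to have size at least ε/2. These weighted differences are not
oscillations of a function, so the derivation is set up for an arbitrary relation. Off the next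
iterate, g is locally bounded on K^α(g,1), so there the first relation implies an oscillation of f
of some fixed positive size, which dies out in ω^ξ₁ stages. With ω^ξ₂ such layers, ω^ξ₁ · ω^ξ₂ =
ω^(ξ₁+ξ₂) stages suffice (`relIter_weighted_subset`); the second relation is symmetric. A union of
two relations loses a point no later than the natural sum of the two ranks predicts
(`le_natSum_of_mem_relIter`), and ω^ξ is closed under natural sums, so the union vanishes at ω^ξ
when both parts do. -/

open Set Order

/-! ### Natural sums of ordinals -/

/-- The natural (Hessenberg) sum of two ordinals. -/
noncomputable def natSum (a b : Ordinal.{0}) : Ordinal.{0} :=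
  max (⨆ x : Iio a, succ (natSum x.1 b)) (⨆ y : Iio b, succ (natSum a y.1))
termination_by (a, b)
decreasing_by
  · exact Prod.Lex.left _ _ x.2
  · exact Prod.Lex.right _ y.2

theorem natSum_lt_natSum_left {a' a : Ordinal.{0}} (h : a' < a) (b : Ordinal.{0}) :
    natSum a' b < natSum a b := by
  rw [natSum.eq_1 a b]
  refine lt_max_of_lt_left ((lt_succ _).trans_le ?_)
  exact Ordinal.le_iSup (fun x : Iio a => succ (natSum x.1 b)) ⟨a', h⟩

theorem natSum_lt_natSum_right (a : Ordinal.{0}) {b' b : Ordinal.{0}} (h : b' < b) :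
    natSum a b' < natSum a b := by
  rw [natSum.eq_1 a b]
  refine lt_max_of_lt_right ((lt_succ _).trans_le ?_)
  exact Ordinal.le_iSup (fun y : Iio b => succ (natSum a y.1)) ⟨b', h⟩

theorem natSum_le {a b c : Ordinal.{0}} (ha : ∀ a' < a, natSum a' b < c)
    (hb : ∀ b' < b, natSum a b' < c) : natSum a b ≤ c := by
  rw [natSum.eq_1 a b]
  exact max_le (Ordinal.iSup_le fun x => succ_le_of_lt (ha x.1 x.2))
    (Ordinal.iSup_le fun y => succ_le_of_lt (hb y.1 y.2))

/-- The natural sum is the least function of two ordinals, on an initial segment, that is strictly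
increasing in each argument. -/
theorem natSum_le_of_strictMono {o : Ordinal.{0}} (t : Ordinal.{0} → Ordinal.{0} → Ordinal.{0})
    (hl : ∀ a < o, ∀ a' < a, ∀ b < o, t a' b < t a b)
    (hr : ∀ a < o, ∀ b < o, ∀ b' < b, t a b' < t a b) :
    ∀ a < o, ∀ b < o, natSum a b ≤ t a b := by
  intro a
  induction a using WellFoundedLT.induction with
  | ind a iha =>
  intro ha b
  induction b using WellFoundedLT.induction with
  | ind b ihb =>
  intro hb
  exact natSum_le
    (fun a' h => (iha a' h (h.trans ha) b hb).trans_lt (hl a ha a' h b hb))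
    (fun b' h => (ihb b' h (h.trans hb)).trans_lt (hr a ha b hb b' h))

theorem mul_add_lt_mul_add_of_lt {p q q' r : Ordinal.{0}} (hq : q < q') (hr : r < p)
    (r' : Ordinal.{0}) : p * q + r < p * q' + r' :=
  calc p * q + r < p * q + p := by gcongr
    _ = p * (q + 1) := by rw [mul_add, mul_one]
    _ ≤ p * q' := by gcongr; exact Order.add_one_le_of_lt hq
    _ ≤ p * q' + r' := le_self_add

theorem div_lt_div_or_eq_and_mod_lt {p a' a : Ordinal.{0}} (h : a' < a) :
    a' / p < a / p ∨ a' / p = a / p ∧ a' % p < a % p := by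
  rcases lt_trichotomy (a' / p) (a / p) with h1 | h1 | h1
  · exact Or.inl h1
  · refine Or.inr ⟨h1, ?_⟩
    rw [← Ordinal.div_add_mod a' p, ← Ordinal.div_add_mod a p, h1] at h
    exact lt_of_add_lt_add_left h
  · exact absurd (Ordinal.div_le_left h.le p) h1.not_ge

/-- At a successor exponent, divide by p = ω^ζ: adding quotients and taking the natural sum of
remainders is strictly increasing in each argument, so by minimality it dominates `natSum`, and it
stays below p * ω. -/
theorem natSum_lt_omega0_opow (ξ : Ordinal.{0}) :
    ∀ a < ω ^ ξ, ∀ b < ω ^ ξ, natSum a b < ω ^ ξ := by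
  induction ξ using Ordinal.limitRecOn with
  | zero =>
    intro a ha b hb
    simp only [Ordinal.opow_zero, Order.lt_one_iff] at ha hb ⊢
    subst ha hb
    exact le_antisymm (natSum_le (fun a' h => absurd h not_lt_zero)
      (fun b' h => absurd h not_lt_zero)) zero_le
  | add_one ζ ih =>
    intro a ha b hb
    have hp : (ω ^ ζ : Ordinal.{0}) ≠ 0 := (Ordinal.opow_pos ζ Ordinal.omega0_pos).ne'
    set p : Ordinal.{0} := ω ^ ζ with hpdef
    have hmod : ∀ a b : Ordinal.{0}, natSum (a % p) (b % p) < p := fun a b =>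
      ih _ (Ordinal.mod_lt a hp) _ (Ordinal.mod_lt b hp)
    rw [Ordinal.opow_add_one, ← hpdef] at ha hb ⊢
    have key := natSum_le_of_strictMono (o := p * ω)
      (fun a b => p * (a / p + b / p) + natSum (a % p) (b % p)) ?_ ?_ a ha b hb
    · refine key.trans_lt ?_
      calc p * (a / p + b / p) + natSum (a % p) (b % p)
          < p * (a / p + b / p + 1) + 0 :=
            mul_add_lt_mul_add_of_lt (lt_add_one _) (hmod a b) 0
        _ < p * ω := by
          rw [add_zero]
          refine mul_lt_mul_of_pos_left ?_ (pos_iff_ne_zero.2 hp)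
          exact Ordinal.isPrincipal_add_omega0 (Ordinal.isPrincipal_add_omega0
            ((Ordinal.lt_mul_iff_div_lt hp).1 ha) ((Ordinal.lt_mul_iff_div_lt hp).1 hb))
            Ordinal.one_lt_omega0
    · intro a ha a' h b hb
      rcases div_lt_div_or_eq_and_mod_lt (p := p) h with h1 | ⟨h1, h2⟩
      · refine mul_add_lt_mul_add_of_lt ?_ (hmod _ _) _
        have ha1 := (Ordinal.lt_mul_iff_div_lt hp).1 ha
        have hb1 := (Ordinal.lt_mul_iff_div_lt hp).1 hb
        -- Ordinal addition is not strictly increasing on the left in general; it is here because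
        -- the quotients are finite.
        obtain ⟨n, hn⟩ := Ordinal.lt_omega0.1 ha1
        obtain ⟨m, hm⟩ := Ordinal.lt_omega0.1 hb1
        obtain ⟨k, hk⟩ := Ordinal.lt_omega0.1 (h1.trans ha1)
        rw [hk, hn] at h1
        rw [hn, hm, hk]
        have h1 : k < n := by exact_mod_cast h1
        exact_mod_cast (by omega : k + m < n + m)
      · simp only [h1]
        gcongr
        exact natSum_lt_natSum_left h2 _
    · intro a ha b hb b' h
      rcases div_lt_div_or_eq_and_mod_lt (p := p) h with h1 | ⟨h1, h2⟩
      · refine mul_add_lt_mul_add_of_lt ?_ (hmod _ _) _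
        gcongr
      · simp only [h1]
        gcongr
        exact natSum_lt_natSum_right _ h2
  | limit ξ hξ ih =>
    intro a ha b hb
    obtain ⟨c, hc, hac⟩ := (Ordinal.lt_opow_of_isSuccLimit Ordinal.omega0_ne_zero hξ).1 ha
    obtain ⟨d, hd, hbd⟩ := (Ordinal.lt_opow_of_isSuccLimit Ordinal.omega0_ne_zero hξ).1 hb
    have hmono : ∀ {c d : Ordinal.{0}}, c ≤ d → (ω ^ c : Ordinal.{0}) ≤ ω ^ d := fun h =>
      Ordinal.opow_le_opow_right Ordinal.omega0_pos h
    exact (ih (max c d) (max_lt hc hd) a (hac.trans_le (hmono (le_max_left _ _)))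
      b (hbd.trans_le (hmono (le_max_right _ _)))).trans_le (hmono (max_lt hc hd).le)

/-! ### Derivations given by relations -/

section Derivation

variable {X : Type u} [TopologicalSpace X]

/-- The points `x ∈ S` such that every open set containing `x` contains two points of `S` that are
related by `R`. -/
def relDeriv (R : X → X → Prop) (S : Set X) : Set X :=
  {x | x ∈ S ∧ ∀ U : Set X, IsOpen U → x ∈ U → ∃ x₁ ∈ U ∩ S, ∃ x₂ ∈ U ∩ S, R x₁ x₂}

/-- The transfinite iterates of `relDeriv R`, starting from the whole space. -/
noncomputable def relIter (R : X → X → Prop) (α : Ordinal.{0}) : Set X :=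
  Ordinal.limitRecOn (motive := fun _ => Set X) α univ
    (fun _ S => relDeriv R S)
    (fun a _ ih => ⋂ b : Ordinal.{0}, ⋂ h : b < a, ih b h)

variable (R : X → X → Prop)

theorem relIter_zero : relIter R 0 = univ :=
  Ordinal.limitRecOn_zero ..

theorem relIter_add_one (α : Ordinal.{0}) : relIter R (α + 1) = relDeriv R (relIter R α) :=
  Ordinal.limitRecOn_add_one ..

theorem relIter_limit {α : Ordinal.{0}} (hα : IsSuccLimit α) :
    relIter R α = ⋂ b : Ordinal.{0}, ⋂ _ : b < α, relIter R b :=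
  Ordinal.limitRecOn_limit _ _ _ _ hα

theorem oscIter_univ_eq_relIter (f : X → ℝ) (ε : ℝ) (α : Ordinal.{0}) :
    oscIter f ε univ α = relIter (fun x y => ε ≤ |f x - f y|) α :=
  rfl

theorem mem_relIter_limit {α : Ordinal.{0}} (hα : IsSuccLimit α) {x : X} :
    x ∈ relIter R α ↔ ∀ b < α, x ∈ relIter R b := by
  simp [relIter_limit R hα]

theorem relIter_antitone : Antitone (relIter R) := by
  intro α β
  induction β using Ordinal.limitRecOn with
  | zero => intro h; rw [nonpos_iff_eq_zero.1 h]
  | add_one β ih =>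
    intro h
    rcases h.eq_or_lt with rfl | h
    · exact le_rfl
    · rw [relIter_add_one]
      exact fun x hx => ih (Order.lt_add_one_iff.1 h) hx.1
  | limit β hβ ih =>
    intro h
    rcases h.eq_or_lt with rfl | h
    · exact le_rfl
    · exact fun x hx => (mem_relIter_limit R hβ).1 hx α h

theorem isClosed_relDeriv {S : Set X} (hS : IsClosed S) : IsClosed (relDeriv R S) := by
  rw [← isOpen_compl_iff, isOpen_iff_forall_mem_open]
  intro x hx
  by_cases hxS : x ∈ S
  · have : ∃ U : Set X, IsOpen U ∧ x ∈ U ∧ ¬ ∃ x₁ ∈ U ∩ S, ∃ x₂ ∈ U ∩ S, R x₁ x₂ := by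
      by_contra h
      exact hx ⟨hxS, fun U hU hxU => by_contra fun h' => h ⟨U, hU, hxU, h'⟩⟩
    obtain ⟨U, hU, hxU, h⟩ := this
    exact ⟨U, fun y hyU hy => h (hy.2 U hU hyU), hU, hxU⟩
  · exact ⟨Sᶜ, fun y hy hy' => hy hy'.1, hS.isOpen_compl, hxS⟩

theorem isClosed_relIter (α : Ordinal.{0}) : IsClosed (relIter R α) := by
  induction α using Ordinal.limitRecOn with
  | zero => rw [relIter_zero]; exact isClosed_univ
  | add_one α ih => rw [relIter_add_one]; exact isClosed_relDeriv R ih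
  | limit α hα ih =>
    rw [relIter_limit R hα]
    exact isClosed_iInter fun b => isClosed_iInter fun h => ih b h

/-- Points are lost only at successor stages, limit iterates being intersections. -/
theorem exists_notMem_relIter_add_one {α : Ordinal.{0}} {x : X} (hx : x ∉ relIter R α) :
    ∃ b < α, x ∉ relIter R (b + 1) := by
  induction α using Ordinal.limitRecOn with
  | zero => exact absurd (by rw [relIter_zero]; trivial) hx
  | add_one α ih => exact ⟨α, lt_add_one α, hx⟩
  | limit α hα ih =>
    rw [mem_relIter_limit R hα] at hx
    push Not at hx
    obtain ⟨b, hb, hxb⟩ := hx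
    obtain ⟨c, hc, hxc⟩ := ih b hb hxb
    exact ⟨c, hc.trans hb, hxc⟩

/-- Only the points of `S` near `x` matter for membership of `x` in the derived set, and a
derivation with respect to a union of two relations is contained in the union of the derivations. -/
theorem mem_relDeriv_or_of_inter_subset {R R₁ R₂ : X → X → Prop} {S S₁ S₂ U : Set X} {x : X}
    (hR : ∀ y z, y ∈ U ∩ S → z ∈ U ∩ S → R y z → R₁ y z ∨ R₂ y z)
    (hU : IsOpen U) (hxU : x ∈ U)
    (h₁ : U ∩ S ⊆ S₁) (h₂ : U ∩ S ⊆ S₂) (hx : x ∈ relDeriv R S) :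
    x ∈ relDeriv R₁ S₁ ∨ x ∈ relDeriv R₂ S₂ := by
  by_contra! h
  have aux : ∀ (R' : X → X → Prop) (S' : Set X), x ∈ S' → x ∉ relDeriv R' S' →
      ∃ V : Set X, IsOpen V ∧ x ∈ V ∧ ∀ y ∈ V ∩ S', ∀ z ∈ V ∩ S', ¬ R' y z := by
    intro R' S' hxS' hx'
    by_contra! hV
    exact hx' ⟨hxS', hV⟩
  obtain ⟨V₁, hV₁, hx₁, hn₁⟩ := aux R₁ S₁ (h₁ ⟨hxU, hx.1⟩) h.1
  obtain ⟨V₂, hV₂, hx₂, hn₂⟩ := aux R₂ S₂ (h₂ ⟨hxU, hx.1⟩) h.2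
  obtain ⟨y, ⟨⟨hyU, hy₁, hy₂⟩, hyS⟩, z, ⟨⟨hzU, hz₁, hz₂⟩, hzS⟩, hyz⟩ :=
    hx.2 (U ∩ (V₁ ∩ V₂)) (hU.inter (hV₁.inter hV₂)) ⟨hxU, hx₁, hx₂⟩
  have hy := (⟨hyU, hyS⟩ : y ∈ U ∩ S)
  have hz := (⟨hzU, hzS⟩ : z ∈ U ∩ S)
  rcases hR y z hy hz hyz with h' | h'
  · exact hn₁ y ⟨hy₁, h₁ hy⟩ z ⟨hz₁, h₁ hz⟩ h'
  · exact hn₂ y ⟨hy₂, h₂ hy⟩ z ⟨hz₂, h₂ hz⟩ h'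

theorem mem_relDeriv_of_inter_subset {R R₁ : X → X → Prop} {S S₁ U : Set X} {x : X}
    (hR : ∀ y z, y ∈ U ∩ S → z ∈ U ∩ S → R y z → R₁ y z) (hU : IsOpen U) (hxU : x ∈ U)
    (h₁ : U ∩ S ⊆ S₁) (hx : x ∈ relDeriv R S) : x ∈ relDeriv R₁ S₁ :=
  (mem_relDeriv_or_of_inter_subset (fun y z hy hz h => Or.inl (hR y z hy hz h)) hU hxU h₁ h₁
    hx).elim id id

/-- Suppose `natSum α β ≤ γ` and x survives stage γ + 1. Near x, points of the iterate γ must lie in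
the iterates α of R₁ and β of R₂, since a smaller rank would contradict induction. One further
derivation then puts x in one of the iterates it avoids. -/
theorem le_natSum_of_mem_relIter {R R₁ R₂ : X → X → Prop}
    (hR : ∀ y z, R y z → R₁ y z ∨ R₂ y z) (γ : Ordinal.{0}) :
    ∀ (x : X) (α β : Ordinal.{0}), x ∈ relIter R γ → x ∉ relIter R₁ (α + 1) →
      x ∉ relIter R₂ (β + 1) → γ ≤ natSum α β := by
  induction γ using Ordinal.limitRecOn with
  | zero => intros; exact zero_le
  | add_one γ ih =>
    intro x α β hx h₁ h₂
    by_contra hlt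
    replace hlt : natSum α β ≤ γ := by
      rwa [not_le, Order.lt_add_one_iff] at hlt
    rw [relIter_add_one] at hx
    have hU : IsOpen ((relIter R₁ (α + 1))ᶜ ∩ (relIter R₂ (β + 1))ᶜ) :=
      (isClosed_relIter R₁ _).isOpen_compl.inter (isClosed_relIter R₂ _).isOpen_compl
    have := mem_relDeriv_or_of_inter_subset (S₁ := relIter R₁ α) (S₂ := relIter R₂ β)
      (fun y z _ _ h => hR y z h) hU ⟨h₁, h₂⟩ ?_ ?_ hx
    · rw [← relIter_add_one, ← relIter_add_one] at this
      exact this.elim h₁ h₂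
    · rintro y ⟨⟨hy₁, hy₂⟩, hy⟩
      by_contra hyα
      obtain ⟨α', hα', hyα'⟩ := exists_notMem_relIter_add_one R₁ hyα
      exact ((ih y α' β hy hyα' hy₂).trans_lt (natSum_lt_natSum_left hα' β)).not_ge hlt
    · rintro y ⟨⟨hy₁, hy₂⟩, hy⟩
      by_contra hyβ
      obtain ⟨β', hβ', hyβ'⟩ := exists_notMem_relIter_add_one R₂ hyβ
      exact ((ih y α β' hy hy₁ hyβ').trans_lt (natSum_lt_natSum_right α hβ')).not_ge hlt
  | limit γ hγ ih =>
    intro x α β hx h₁ h₂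
    rw [mem_relIter_limit R hγ] at hx
    exact hγ.isSuccPrelimit.le_iff_forall_le.2 fun b hb => ih b hb x α β (hx b hb) h₁ h₂

/-- If the iterates of two derivations vanish at `ω ^ ξ`, so do those of their union. -/
theorem relIter_omega0_opow_eq_empty {R R₁ R₂ : X → X → Prop}
    (hR : ∀ y z, R y z → R₁ y z ∨ R₂ y z) {ξ : Ordinal.{0}}
    (h₁ : relIter R₁ (ω ^ ξ) = ∅) (h₂ : relIter R₂ (ω ^ ξ) = ∅) :
    relIter R (ω ^ ξ) = ∅ := by
  refine eq_empty_of_forall_notMem fun x hx => ?_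
  obtain ⟨α, hα, hxα⟩ := exists_notMem_relIter_add_one R₁ (h₁ ▸ notMem_empty x)
  obtain ⟨β, hβ, hxβ⟩ := exists_notMem_relIter_add_one R₂ (h₂ ▸ notMem_empty x)
  exact (le_natSum_of_mem_relIter hR _ x α β hx hxα hxβ).not_gt
    (natSum_lt_omega0_opow ξ α hα β hβ)

/-! ### Weighted oscillation -/

/-- Where `g` is bounded, the oscillation of `f` weighted by `g` is controlled by that of `f`; the
space is exhausted by layers on which `g` has local oscillation less than `1`. -/
theorem relIter_weighted_subset {f g : X → ℝ} {ε : ℝ} (hε : 0 < ε) {R : X → X → Prop}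
    (hR : ∀ y z, R y z → ε ≤ |g y| * |f y - f z| ∨ ε ≤ |g z| * |f y - f z|)
    {η : Ordinal.{0}} (hη : 0 < η) (hf : ∀ δ > 0, oscIter f δ univ η = ∅) (α : Ordinal.{0}) :
    relIter R (η * α) ⊆ oscIter g 1 univ α := by
  induction α using Ordinal.limitRecOn with
  | zero => rw [oscIter_zero]; exact subset_univ _
  | add_one α ih =>
    intro x hx
    by_contra hxα
    have hxg : x ∈ oscIter g 1 univ α :=
      ih (relIter_antitone R (by gcongr; exact (lt_add_one α).le) hx)
    rw [oscIter_add_one] at hxα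
    obtain ⟨U, hU, hxU, hUg⟩ : ∃ U : Set X, IsOpen U ∧ x ∈ U ∧
        ∀ y ∈ U ∩ oscIter g 1 univ α, ∀ z ∈ U ∩ oscIter g 1 univ α, |g y - g z| < 1 := by
      by_contra! hV
      exact hxα ⟨hxg, hV⟩
    have hN : 0 < |g x| + 1 := by positivity
    have hbound : ∀ y ∈ U ∩ oscIter g 1 univ α, |g y| ≤ |g x| + 1 := by
      intro y hy
      have h1 := hUg y hy x ⟨hxU, hxg⟩
      have h2 := abs_sub_abs_le_abs_sub (g y) (g x)
      linarith
    -- After stage η * α only points of the layer α of g remain; on U the weight is at most |g x| +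
    -- 1 there, so each R-step inside U is a step for f at the rescaled threshold.
    have hlayer : ∀ γ : Ordinal.{0},
        U ∩ relIter R (η * α + γ) ⊆ oscIter f (ε / (|g x| + 1)) univ γ := by
      intro γ
      induction γ using Ordinal.limitRecOn with
      | zero => rw [oscIter_zero]; exact subset_univ _
      | add_one γ ihγ =>
        rintro y ⟨hyU, hy⟩
        rw [← add_assoc, relIter_add_one] at hy
        rw [oscIter_univ_eq_relIter, relIter_add_one]
        refine mem_relDeriv_of_inter_subset ?_ hU hyU ihγ hy
        have hsub : relIter R (η * α + γ) ⊆ oscIter g 1 univ α :=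
          (relIter_antitone R le_self_add).trans ih
        intro v w hv hw hvw
        rw [div_le_iff₀' hN]
        have hv' := hbound v ⟨hv.1, hsub hv.2⟩
        have hw' := hbound w ⟨hw.1, hsub hw.2⟩
        rcases hR v w hvw with h | h
        · exact h.trans (by gcongr)
        · exact h.trans (by gcongr)
      | limit γ hγ ihγ =>
        rintro y ⟨hyU, hy⟩
        rw [mem_relIter_limit R (Ordinal.isSuccLimit_add _ hγ)] at hy
        rw [oscIter_univ_eq_relIter, mem_relIter_limit _ hγ]
        exact fun b hb => ihγ b hb ⟨hyU, hy _ (by gcongr)⟩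
    have := hlayer η ⟨hxU, by rwa [mul_add, mul_one] at hx⟩
    rw [hf _ (by positivity)] at this
    exact this
  | limit α hα ih =>
    intro x hx
    rw [oscIter_univ_eq_relIter, mem_relIter_limit _ hα]
    rw [mem_relIter_limit R (Ordinal.isSuccLimit_mul_right hη hα)] at hx
    exact fun b hb => ih b hb (hx _ (mul_lt_mul_of_pos_left hb hη))

end Derivation

/-! ### Products of functions of small Baire class -/

theorem omega0_opow_lt_omega_one {ξ : Ordinal.{0}} (hξ : ξ < ω_ 1) : ω ^ ξ < ω_ 1 :=
  Ordinal.isPrincipal_opow_omega 1 Ordinal.omega0_lt_omega_one hξ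

/-- Countability of `o` matters: it rules out the default value ω₁ of the index. -/
theorem oscIndex_le_iff {X : Type u} [TopologicalSpace X] {f : X → ℝ} {o : Ordinal.{0}}
    (ho : o < ω_ 1) :
    oscIndex f univ ≤ o ↔ ∀ ε > 0, oscIter f ε univ o = ∅ := by
  rw [isLUB_le_iff (oscIndex_isLUB f univ)]
  constructor
  · intro h ε hε
    have hle := h ⟨ε, hε, rfl⟩
    unfold oscIndexAt at hle
    split_ifs at hle with hex
    · have hmem := csInf_mem (s := {α : Ordinal.{0} | α < ω_ 1 ∧ oscIter f ε univ α = ∅}) hex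
      exact subset_empty_iff.1 ((relIter_antitone _ hle).trans hmem.2.subset)
    · exact absurd hle ho.not_ge
  · rintro h _ ⟨ε, hε, rfl⟩
    unfold oscIndexAt
    rw [if_pos ⟨o, ho, h ε hε⟩]
    exact csInf_le' ⟨ho, h ε hε⟩

theorem IsBaireOne.mul {X : Type u} [TopologicalSpace X] {f g : X → ℝ} (hf : IsBaireOne f)
    (hg : IsBaireOne g) : IsBaireOne fun x => f x * g x := by
  obtain ⟨F, hF, hF'⟩ := hf
  obtain ⟨G, hG, hG'⟩ := hg
  exact ⟨fun n x => F n x * G n x, fun n => (hF n).mul (hG n), fun x => (hF' x).mul (hG' x)⟩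

theorem half_le_or_half_le_of_le_abs_mul_sub_mul {a b c d ε : ℝ} (h : ε ≤ |a * c - b * d|) :
    ε / 2 ≤ |d| * |a - b| ∨ ε / 2 ≤ |a| * |c - d| := by
  have h1 : |a * c - b * d| ≤ |d| * |a - b| + |a| * |c - d| := by
    rw [← abs_mul, ← abs_mul]
    calc |a * c - b * d| = |d * (a - b) + a * (c - d)| := by ring_nf
      _ ≤ _ := abs_add_le _ _
  by_contra! h2
  linarith [h2.1, h2.2]

theorem theorem6 {K : Type u} [MetricSpace K] [CompactSpace K]
    (ξ₁ ξ₂ : Ordinal.{0}) (hξ₁ : ξ₁ < ω_ 1) (hξ₂ : ξ₂ < ω_ 1)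
    (f g : K → ℝ) (hf : f ∈ smallBaireClass K ξ₁) (hg : g ∈ smallBaireClass K ξ₂) :
    (fun x => f x * g x) ∈ smallBaireClass K (max (ξ₁ + ξ₂) (ξ₂ + ξ₁)) := by
  have hξ : max (ξ₁ + ξ₂) (ξ₂ + ξ₁) < ω_ 1 :=
    max_lt (Ordinal.isPrincipal_add_omega 1 hξ₁ hξ₂) (Ordinal.isPrincipal_add_omega 1 hξ₂ hξ₁)
  have hf' := (oscIndex_le_iff (omega0_opow_lt_omega_one hξ₁)).1 hf.2
  have hg' := (oscIndex_le_iff (omega0_opow_lt_omega_one hξ₂)).1 hg.2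
  refine ⟨hf.1.mul hg.1, (oscIndex_le_iff (omega0_opow_lt_omega_one hξ)).2 fun ε hε => ?_⟩
  rw [oscIter_univ_eq_relIter]
  refine relIter_omega0_opow_eq_empty
    (R₁ := fun x y => ε / 2 ≤ |g y| * |f x - f y|)
    (R₂ := fun x y => ε / 2 ≤ |f x| * |g x - g y|)
    (fun y z h => half_le_or_half_le_of_le_abs_mul_sub_mul h) ?_ ?_
  -- The layers come from g and the stages within each from f; the other term exchanges the roles,
  -- hence the maximum of both orders of addition.
  · rw [← subset_empty_iff, ← hg' 1 one_pos]
    refine Subset.trans ?_ (relIter_weighted_subset (half_pos hε) (fun y z h => Or.inr h)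
      (Ordinal.opow_pos ξ₁ Ordinal.omega0_pos) hf' (ω ^ ξ₂))
    rw [← Ordinal.opow_add]
    exact relIter_antitone _ (Ordinal.opow_le_opow_right Ordinal.omega0_pos (le_max_left _ _))
  · rw [← subset_empty_iff, ← hf' 1 one_pos]
    refine Subset.trans ?_ (relIter_weighted_subset (half_pos hε) (fun y z h => Or.inl h)
      (Ordinal.opow_pos ξ₂ Ordinal.omega0_pos) hg' (ω ^ ξ₁))
    rw [← Ordinal.opow_add]
    exact relIter_antitone _ (Ordinal.opow_le_opow_right Ordinal.omega0_pos (le_max_right _ _))
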